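/- Let $p$ be an odd prime, and let $G$ and $H$ be nontrivial finite groups, each of exponent $p$ and nilpotent of class at most $2$. Let $F = G * H$ be their free product, let $F_1 = F$, $F_{n+1} = [F_n, F]$ be the terms of the lower central series of $F$, and let $G \amalg^{\mathfrak{N}_2} H = F/F_3$ be the $2$-nilpotent product of $G$ and $H$ (their coproduct in the class of groups of nilpotency class at most $2$). Then $G \amalg^{\mathfrak{N}_2} H$ is capable, that is, there exists a group $K$ such that $G \amalg^{\mathfrak{N}_2} H \cong K/Z(K)$, where $Z(K)$ is the center of $K$. -/

import Mathlib

universe u v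

/-- A group is capable if it is isomorphic to `K / Z(K)` for some group `K`. (A witness in any
universe can be replaced by its subgroup generated by lifts of the elements of `G`, so it is no
restriction to look for `K` in the universe of `G`.) -/
def IsCapable (G : Type u) [Group G] : Prop :=
  ∃ (K : Type u) (_ : Group K), Nonempty (G ≃* K ⧸ Subgroup.center K)

/-- `G` is nilpotent of class at most `k`: the term `G_{k+1}` of the lower central series
`G_1 = G`, `G_{n+1} = [G_n, G]` is trivial. (Mathlib's indexing starts at `0`.) -/
def ClassAtMost (k : ℕ) (G : Type u) [Group G] : Prop :=
  (⊤ : Subgroup G).lowerCentralSeries k = ⊥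

/-- The `k`-nilpotent product of `G` and `H`: the quotient `F / F_{k+1}` of the free product
`F = G * H` by the `(k+1)`-st term of its lower central series, where `F_1 = F`. -/
abbrev NilpotentProduct (k : ℕ) (G : Type u) (H : Type v) [Group G] [Group H] : Type (max u v) :=
  Monoid.Coprod G H ⧸ (⊤ : Subgroup (Monoid.Coprod G H)).lowerCentralSeries k

/-! Take K = F/F_4. Its center contains F_3/F_4, so it suffices that [x, F] ≤ F_4 forces x ∈ F_3.
The detectors are cocycles w from F to functions G → ZMod p, on which F acts through G by
translation: w vanishes on G and sends h ∈ H to β(h)f, where β is a character of H and f is killed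
by the cube of the augmentation ideal. Such a w vanishes on F_4, so [x, y] ∈ F_4 gives w x + x·w y =
w y + y·w x (`cocycle_comm`).

For y ∈ H with β(y) ≠ 0, this makes f invariant under the G-component of x. Quadratic f separate
points by the Baer correspondence (`exists_quadratic_ne`), so that component is 1; by symmetry so is
the H-component. Modulo F_3, x is then a product d of commutators [g, h]^±1. If d ∉ F_3, a character
detects d and turns [g, h] into a bilinear form Σ αᵢ(g)βᵢ(h). The cocycles with f = αᵢ² recover
twice its value on d, while commutation with elements of G forces this to be 0
(`mem_lowerCentralSeries_two_of_mem_closure`). -/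

open scoped commutatorElement

/-! ### Cocycles and the augmentation filtration -/

section Filtration

variable {Γ M : Type*} [Group Γ] [AddCommGroup M]

/-- The ascending filtration of a `Γ`-module `M` whose term `n` is annihilated by the `n`-th power
of the augmentation ideal. -/
def augFiltration (φ : Γ →* AddMonoid.End M) : ℕ → AddSubgroup M
  | 0 => ⊥
  | n + 1 => ⨅ g, (augFiltration φ n).comap (φ g - 1 : AddMonoid.End M)

variable {φ : Γ →* AddMonoid.End M}

theorem mem_augFiltration_zero {m : M} : m ∈ augFiltration φ 0 ↔ m = 0 := Iff.rfl

theorem mem_augFiltration_succ {n : ℕ} {m : M} :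
    m ∈ augFiltration φ (n + 1) ↔ ∀ g, φ g m - m ∈ augFiltration φ n := by
  simp only [augFiltration, AddSubgroup.mem_iInf]
  rfl

theorem sub_mem_augFiltration {n : ℕ} {m : M} (hm : m ∈ augFiltration φ n) (g : Γ) :
    φ g m - m ∈ augFiltration φ (n - 1) := by
  cases n with
  | zero => rw [mem_augFiltration_zero] at hm; simp [hm]
  | succ n => exact mem_augFiltration_succ.1 hm g

theorem augFiltration_mono : Monotone (augFiltration φ) := by
  refine monotone_nat_of_le_succ fun n => ?_
  induction n with
  | zero => exact bot_le
  | succ n ih =>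
    exact fun m hm => mem_augFiltration_succ.2 fun g => ih (mem_augFiltration_succ.1 hm g)

theorem apply_mem_augFiltration {n : ℕ} {m : M} (hm : m ∈ augFiltration φ n) (g : Γ) :
    φ g m ∈ augFiltration φ n := by
  have := add_mem (augFiltration_mono (Nat.sub_le n 1) (sub_mem_augFiltration hm g)) hm
  rwa [sub_add_cancel] at this

theorem map_mul_apply (φ : Γ →* AddMonoid.End M) (g h : Γ) (m : M) :
    φ (g * h) m = φ g (φ h m) := by
  rw [map_mul]; rfl

theorem map_one_apply (φ : Γ →* AddMonoid.End M) (m : M) : φ 1 m = m := by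
  rw [map_one]; rfl

theorem map_apply_inv_apply (φ : Γ →* AddMonoid.End M) (g : Γ) (m : M) : φ g (φ g⁻¹ m) = m := by
  rw [← map_mul_apply, mul_inv_cancel, map_one_apply]

/-- Rests on ([a,b] - 1)ba = (a - 1)(b - 1) - (b - 1)(a - 1) in the group ring. -/
theorem sub_mem_augFiltration_of_mem_lowerCentralSeries {i : ℕ} {g : Γ}
    (hg : g ∈ (⊤ : Subgroup Γ).lowerCentralSeries i) {n : ℕ} {m : M}
    (hm : m ∈ augFiltration φ n) : φ g m - m ∈ augFiltration φ (n - (i + 1)) := by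
  induction i generalizing g n m with
  | zero => exact sub_mem_augFiltration hm g
  | succ i ih =>
    rw [Subgroup.mem_lowerCentralSeries_succ_iff] at hg
    induction hg using Subgroup.closure_induction generalizing m with
    | mem x hx =>
      obtain ⟨a, ha, b, -, rfl⟩ := hx
      obtain ⟨m', hm', rfl⟩ : ∃ m' ∈ augFiltration φ n, φ (b * a) m' = m :=
        ⟨φ (b * a)⁻¹ m, apply_mem_augFiltration hm _, map_apply_inv_apply _ _ _⟩
      have h1 := ih ha (sub_mem_augFiltration hm' b)
      have h2 := sub_mem_augFiltration (ih ha hm') b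
      rw [show n - 1 - (i + 1) = n - (i + 1 + 1) by omega] at h1
      rw [show n - (i + 1) - 1 = n - (i + 1 + 1) by omega] at h2
      have h3 := sub_mem h1 h2
      rw [← map_mul_apply, show ⁅a, b⁆ * (b * a) = a * b by simp [commutatorElement_def]]
      simp only [map_sub, ← map_mul_apply] at h3
      convert h3 using 1
      abel
    | one => simp
    | mul x y _ _ hx hy =>
      rw [map_mul_apply]
      convert add_mem (apply_mem_augFiltration (hy hm) x) (hx hm) using 1
      simp
    | inv x _ hx =>
      convert neg_mem (hx (apply_mem_augFiltration hm x⁻¹)) using 1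
      simp [map_apply_inv_apply]

variable {w : Γ → M} (hw : ∀ x y, w (x * y) = w x + φ x (w y))
include hw

theorem cocycle_one : w 1 = 0 := by
  simpa [map_one_apply] using hw 1 1

theorem cocycle_inv (x : Γ) : w x⁻¹ = -φ x⁻¹ (w x) := by
  have := hw x⁻¹ x
  rw [inv_mul_cancel, cocycle_one hw] at this
  exact eq_neg_of_add_eq_zero_left this.symm

theorem cocycle_commutator (x y : Γ) :
    w ⁅x, y⁆ = w x + φ x (w y) - φ ⁅x, y⁆ (w y + φ y (w x)) := by
  rw [← hw, ← hw, show x * y = ⁅x, y⁆ * (y * x) by simp [commutatorElement_def], hw ⁅x, y⁆]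
  simp

/-- In w[a,b] = (a - 1)w b - ([a,b] - 1)w b - ([a,b]b - 1)w a, every term lies at least i + 1
degrees below c. -/
theorem cocycle_mem_augFiltration {c : ℕ} (hc : ∀ x, w x ∈ augFiltration φ c) {i : ℕ} {x : Γ}
    (hx : x ∈ (⊤ : Subgroup Γ).lowerCentralSeries i) : w x ∈ augFiltration φ (c - i) := by
  induction i generalizing x with
  | zero => exact hc x
  | succ i ih =>
    rw [Subgroup.mem_lowerCentralSeries_succ_iff] at hx
    induction hx using Subgroup.closure_induction with
    | mem x hx =>
      obtain ⟨a, ha, b, -, rfl⟩ := hx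
      have hab : ⁅a, b⁆ ∈ (⊤ : Subgroup Γ).lowerCentralSeries (i + 1) :=
        Subgroup.commutator_mem_commutator ha trivial
      have h1 := sub_mem_augFiltration_of_mem_lowerCentralSeries ha (hc b)
      have h2 := augFiltration_mono (show c - (i + 1 + 1) ≤ c - (i + 1) by omega)
        (sub_mem_augFiltration_of_mem_lowerCentralSeries hab (hc b))
      have h3 := sub_mem_augFiltration (ih ha) (⁅a, b⁆ * b)
      rw [show c - i - 1 = c - (i + 1) by omega] at h3
      convert sub_mem (sub_mem h1 h2) h3 using 1
      rw [cocycle_commutator hw, map_add, map_mul_apply]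
      abel
    | one => rw [cocycle_one hw]; exact zero_mem _
    | mul x y _ _ hx hy => rw [hw]; exact add_mem hx (apply_mem_augFiltration hy x)
    | inv x _ hx => rw [cocycle_inv hw]; exact neg_mem (apply_mem_augFiltration hx _)

theorem cocycle_comm {c : ℕ} (hc : ∀ x, w x ∈ augFiltration φ c) {x y : Γ}
    (hxy : ⁅x, y⁆ ∈ (⊤ : Subgroup Γ).lowerCentralSeries c) :
    w x + φ x (w y) = w y + φ y (w x) := by
  have h1 := cocycle_mem_augFiltration hw hc hxy
  have h2 := sub_mem_augFiltration_of_mem_lowerCentralSeries hxy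
    (add_mem (hc y) (apply_mem_augFiltration (hc x) y))
  rw [Nat.sub_self, mem_augFiltration_zero, cocycle_commutator hw, sub_eq_zero] at h1
  rw [Nat.sub_eq_zero_of_le (Nat.le_succ c), mem_augFiltration_zero, sub_eq_zero] at h2
  rw [h1, h2]

end Filtration

/-! ### Cocycles on a free product -/

section Coprod

open Monoid.Coprod

variable {G : Type u} {H : Type v} [Group G] [Group H] {M : Type*} [AddCommGroup M]

/-- Letting G act linearly and H by translations gives an affine action of the free product; w x is
the image of 0 under x. -/
theorem exists_coprod_cocycle (ψ : G →* AddMonoid.End M) (b : H →* Multiplicative M) :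
    ∃ w : Monoid.Coprod G H → M,
      (∀ x y, w (x * y) = w x + ψ.comp fst x (w y)) ∧ (∀ g, w (inl g) = 0) ∧
        ∀ h, w (inr h) = (b h).toAdd := by
  let Φ : Monoid.Coprod G H →* Function.End M := lift
    { toFun := fun g m => ψ g m
      map_one' := funext fun m => map_one_apply ψ m
      map_mul' := fun g g' => funext fun m => map_mul_apply ψ g g' m }
    { toFun := fun h m => (b h).toAdd + m
      map_one' := funext fun m => by rw [map_one]; exact zero_add m
      map_mul' := fun h h' => funext fun m => by
        simp only [map_mul, toAdd_mul, add_assoc]; rfl }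
  have hl (g : G) (m : M) : Φ (inl g) m = ψ g m := rfl
  have hr (h : H) (m : M) : Φ (inr h) m = (b h).toAdd + m := rfl
  have hm (x y) (m : M) : Φ (x * y) m = Φ x (Φ y m) := by rw [map_mul]; rfl
  have key (x) : ∀ m, Φ x m = Φ x 0 + ψ.comp fst x m := by
    induction x using Monoid.Coprod.induction_on with
    | inl g => intro m; simp [hl]
    | inr h => intro m; simp [hr]
    | mul x y hx hy =>
      intro m
      rw [hm, hm, hx, hy, hx (Φ y 0), map_add, map_mul_apply, add_assoc]
  exact ⟨fun x => Φ x 0, fun x y => by simp only [hm]; exact key x _, fun g => by simp [hl],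
    fun h => by simp [hr]⟩

theorem coprod_cocycle_mem {φ : Monoid.Coprod G H →* AddMonoid.End M} {c : ℕ}
    {w : Monoid.Coprod G H → M}
    (hw : ∀ x y, w (x * y) = w x + φ x (w y)) (hl : ∀ g, w (inl g) ∈ augFiltration φ c)
    (hr : ∀ h, w (inr h) ∈ augFiltration φ c) (x) : w x ∈ augFiltration φ c := by
  induction x using Monoid.Coprod.induction_on with
  | inl g => exact hl g
  | inr h => exact hr h
  | mul x y hx hy => rw [hw]; exact add_mem hx (apply_mem_augFiltration hy x)

end Coprod

section Translation

/-- The action of `G` on functions on `G` by right translation. -/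
def translation (G A : Type*) [Group G] [AddCommGroup A] : G →* AddMonoid.End (G → A) where
  toFun g :=
    { toFun := fun f y => f (y * g)
      map_zero' := rfl
      map_add' := fun _ _ => rfl }
  map_one' := by ext f y; exact congrArg f (mul_one y)
  map_mul' g h := by ext f y; exact congrArg f (mul_assoc _ _ _).symm

@[simp]
theorem translation_apply {G A : Type*} [Group G] [AddCommGroup A] (g : G) (f : G → A) (y : G) :
    translation G A g f y = f (y * g) := rfl

end Translation

/-! ### Characters of groups of exponent p -/

section Functionals

variable {p : ℕ} [Fact p.Prime]

theorem exists_addHom_zmod_ne_zero {A : Type*} [AddCommGroup A] [Module (ZMod p) A] {a : A}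
    (ha : a ≠ 0) : ∃ f : A →+ ZMod p, f a ≠ 0 := by
  by_contra! h
  exact ha ((Module.forall_dual_apply_eq_zero_iff (ZMod p) a).1 fun f => h f.toAddMonoidHom)

theorem exists_hom_zmod_ne_one {A : Type*} [CommGroup A] (hA : ∀ x : A, x ^ p = 1) {a : A}
    (ha : a ≠ 1) : ∃ f : A →* Multiplicative (ZMod p), f a ≠ 1 := by
  let _ : Module (ZMod p) (Additive A) := AddCommGroup.zmodModule fun x => hA x.toMul
  obtain ⟨f, hf⟩ := exists_addHom_zmod_ne_zero (p := p) (A := Additive A) (a := Additive.ofMul a) ha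
  exact ⟨AddMonoidHom.toMultiplicativeRight f, hf⟩

omit [Fact p.Prime] in
theorem pow_abelianization_eq_one {G : Type*} [Group G] (hG : ∀ x : G, x ^ p = 1)
    (x : Abelianization G) : x ^ p = 1 := by
  obtain ⟨g, rfl⟩ := QuotientGroup.mk_surjective x
  exact (map_pow Abelianization.of g p).symm.trans (by rw [hG, map_one])

theorem exists_hom_zmod_ne_one_of_isSolvable (G : Type*) [Group G] [Group.IsSolvable G]
    [Nontrivial G] (hG : ∀ x : G, x ^ p = 1) :
    ∃ (f : G →* Multiplicative (ZMod p)) (g : G), f g ≠ 1 := by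
  obtain ⟨g, -, hg⟩ := SetLike.exists_of_lt (Group.IsSolvable.commutator_lt_top_of_nontrivial G)
  obtain ⟨f, hf⟩ := exists_hom_zmod_ne_one (pow_abelianization_eq_one hG)
    (a := Abelianization.of g) (by rwa [ne_eq, ← MonoidHom.mem_ker, Abelianization.ker_of])
  exact ⟨f.comp Abelianization.of, g, hf⟩

theorem exists_dual_family_add (A : Type*) [AddCommGroup A] [Finite A] [Module (ZMod p) A] :
    ∃ (n : ℕ) (e : Fin n → A) (α : Fin n → A →+ ZMod p), (∀ i, α i (e i) = 1) ∧
      ∀ (b : A →+ ZMod p) (a : A), b a = ∑ i, α i a * b (e i) := by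
  have : Module.Finite (ZMod p) A := Module.Finite.of_finite
  let e := Module.finBasis (ZMod p) A
  refine ⟨_, e, fun i => (e.coord i).toAddMonoidHom, fun i => ?_, fun b a => ?_⟩
  · change e.coord i (e i) = 1
    simp
  · have hB (x : A) : b.toZModLinearMap p x = b x := rfl
    rw [← hB]
    conv_lhs => rw [← e.sum_repr a, map_sum]
    exact Finset.sum_congr rfl fun i _ => by rw [map_smul, smul_eq_mul, hB]; rfl

/-- Dual families for the maximal elementary abelian quotient of a finite group. -/
theorem exists_dual_family (G : Type*) [Group G] [Finite G] (hG : ∀ x : G, x ^ p = 1) :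
    ∃ (n : ℕ) (γ : Fin n → G) (α : Fin n → G →* Multiplicative (ZMod p)),
      (∀ i, (α i (γ i)).toAdd = 1) ∧ ∀ (b : G →* Multiplicative (ZMod p)) (g : G),
        (b g).toAdd = ∑ i, (α i g).toAdd * (b (γ i)).toAdd := by
  let _ : Module (ZMod p) (Additive (Abelianization G)) :=
    AddCommGroup.zmodModule fun x => pow_abelianization_eq_one hG x.toMul
  obtain ⟨n, e, α, hα, hb⟩ := exists_dual_family_add (p := p) (Additive (Abelianization G))
  have hs (i) : ∃ g : G, Additive.ofMul (Abelianization.of g) = e i :=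
    QuotientGroup.mk_surjective (e i).toMul
  choose γ hγ using hs
  refine ⟨n, γ, fun i => (AddMonoidHom.toMultiplicativeRight (α i)).comp Abelianization.of,
    fun i => ?_, fun b g => ?_⟩
  · rw [← hα i, ← hγ i]
    rfl
  · have := hb (MonoidHom.toAdditiveLeft (Abelianization.lift b))
      (Additive.ofMul (Abelianization.of g))
    simp only [← hγ] at this
    exact this

end Functionals

/-! ### Class two and the Baer correspondence -/

section ClassTwo

variable {G : Type u} [Group G]

theorem ClassAtMost.commute_commutatorElement (hG : ClassAtMost 2 G) (x y z : G) :
    Commute ⁅x, y⁆ z := by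
  have h : ⁅⁅x, y⁆, z⁆ ∈ (⊤ : Subgroup G).lowerCentralSeries 2 :=
    Subgroup.commutator_mem_commutator (Subgroup.commutator_mem_commutator trivial trivial) trivial
  rw [hG, Subgroup.mem_bot] at h
  exact commutatorElement_eq_one_iff_commute.1 h

variable (hc : ∀ x y z : G, Commute ⁅x, y⁆ z)
include hc

theorem commutatorElement_mul_left_of_central (x y z : G) : ⁅x * y, z⁆ = ⁅x, z⁆ * ⁅y, z⁆ := by
  rw [commutatorElement_mul_left_eq_conj_mul, ← (hc y z x).eq, mul_inv_cancel_right,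
    (hc y z _).eq]

theorem commutatorElement_mul_right_of_central (x y z : G) : ⁅x, y * z⁆ = ⁅x, y⁆ * ⁅x, z⁆ := by
  rw [← commutatorElement_inv, commutatorElement_mul_left_of_central hc, mul_inv_rev,
    commutatorElement_inv, commutatorElement_inv, (hc x z _).eq]

theorem commutatorElement_pow_left_of_central (x z : G) (n : ℕ) : ⁅x ^ n, z⁆ = ⁅x, z⁆ ^ n := by
  induction n with
  | zero => simp
  | succ n ih => rw [pow_succ, pow_succ, commutatorElement_mul_left_of_central hc, ih]

/-- The Baer correspondence: in a group of class at most two and odd exponent `2 k - 1` the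
operation `x * y * ⁅y, x⁆ ^ k` is an abelian group structure. -/
theorem exists_commGroup_baer {k p : ℕ} (hk : 2 * k = p + 1) (hp : ∀ x : G, x ^ p = 1) :
    ∃ (A : Type u) (_ : CommGroup A) (e : G ≃ A),
      ∀ x y, e x * e y = e (x * y * ⁅y, x⁆ ^ k) := by
  have hck (x y z : G) : Commute (⁅x, y⁆ ^ k) z := (hc x y z).pow_left k
  have hr {w : G} (hw : ∀ z, Commute w z) (x y : G) : ⁅x, y * w⁆ = ⁅x, y⁆ := by
    rw [commutatorElement_mul_right_of_central hc,
      commutatorElement_eq_one_iff_commute.2 (hw x).symm, mul_one]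
  have hl {w : G} (hw : ∀ z, Commute w z) (x y : G) : ⁅y * w, x⁆ = ⁅y, x⁆ := by
    rw [commutatorElement_mul_left_of_central hc,
      commutatorElement_eq_one_iff_commute.2 (hw x), mul_one]
  let m (x y : G) : G := x * y * ⁅y, x⁆ ^ k
  have assoc (x y z : G) : m (m x y) z = m x (m y z) := by
    change x * y * ⁅y, x⁆ ^ k * z * ⁅z, x * y * ⁅y, x⁆ ^ k⁆ ^ k =
      x * (y * z * ⁅z, y⁆ ^ k) * ⁅y * z * ⁅z, y⁆ ^ k, x⁆ ^ k
    rw [hr (hck y x), hl (hck z y), commutatorElement_mul_right_of_central hc,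
      commutatorElement_mul_left_of_central hc, (hc z x _).mul_pow, (hc y x _).mul_pow]
    have h1 := hck y x
    have h3 := hck z y
    generalize ⁅y, x⁆ ^ k = a at *
    generalize ⁅z, x⁆ ^ k = b at *
    generalize ⁅z, y⁆ ^ k = c at *
    simp only [mul_assoc]
    rw [(h3 _).eq, (h1 _).eq]
    simp only [mul_assoc]
    rw [(h3 a).eq, (h1 (b * c)).eq, mul_assoc, (h1 c).eq]
  have one_mul' (x : G) : m 1 x = x := by simp [m]
  have inv_mul' (x : G) : m x⁻¹ x = 1 := by
    simp [m, commutatorElement_eq_one_iff_commute.2 (Commute.refl x).inv_right]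
  have comm (x y : G) : m x y = m y x := by
    -- As 2k = p + 1, the k-th power is a square root.
    have h : ⁅x, y⁆ = ⁅x, y⁆ ^ k * ⁅x, y⁆ ^ k := by
      rw [← pow_add, ← two_mul, hk, pow_succ, hp, one_mul]
    change x * y * ⁅y, x⁆ ^ k = y * x * ⁅x, y⁆ ^ k
    rw [show x * y = ⁅x, y⁆ * (y * x) by simp [commutatorElement_def], (hc x y _).eq,
      ← commutatorElement_inv x y, inv_pow, mul_assoc]
    nth_rewrite 1 [h]
    rw [mul_inv_cancel_right]
  -- An opaque copy of `G` keeps the two multiplications apart.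
  obtain ⟨A, ⟨e⟩⟩ : ∃ A : Type u, Nonempty (G ≃ A) := ⟨G, ⟨Equiv.refl G⟩⟩
  exact ⟨A,
    { mul := fun a b => e (m (e.symm a) (e.symm b))
      one := e 1
      inv := fun a => e (e.symm a)⁻¹
      mul_assoc := fun a b c => by
        change e (m (e.symm (e _)) _) = e (m _ (e.symm (e _)))
        simp only [Equiv.symm_apply_apply, assoc]
      one_mul := fun a => by
        change e (m (e.symm (e _)) _) = _
        simp only [Equiv.symm_apply_apply, one_mul', Equiv.apply_symm_apply]
      mul_one := fun a => by
        change e (m _ (e.symm (e _))) = _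
        simp only [Equiv.symm_apply_apply, comm _ 1, one_mul', Equiv.apply_symm_apply]
      inv_mul_cancel := fun a => by
        change e (m (e.symm (e _)) _) = e 1
        simp only [Equiv.symm_apply_apply, inv_mul']
      mul_comm := fun a b => congrArg e (comm _ _) }, e, fun x y => by
        change e (m (e.symm (e x)) (e.symm (e y))) = _
        simp only [Equiv.symm_apply_apply, m]⟩

/-- In a group of class at most two and odd prime exponent, quadratic functions with values in
`ZMod p` separate points. -/
theorem exists_quadratic_ne {p : ℕ} (hp : p.Prime) (hodd : Odd p) (hG : ∀ x : G, x ^ p = 1)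
    {a : G} (ha : a ≠ 1) :
    ∃ (q : G → ZMod p) (B : G → G → ZMod p), (∀ x y, q (x * y) = q x + q y + B x y) ∧
      (∀ x y z, B (x * y) z = B x z + B y z) ∧ q a ≠ q 1 := by
  have := Fact.mk hp
  obtain ⟨k, hk⟩ : ∃ k, 2 * k = p + 1 := by
    obtain ⟨m, rfl⟩ := hodd
    exact ⟨m + 1, by ring⟩
  obtain ⟨A, _, e, he⟩ := exists_commGroup_baer hc hk hG
  have hcentral {w : G} (hw : ∀ z, Commute w z) (x : G) : e (x * w) = e x * e w := by
    rw [he, commutatorElement_eq_one_iff_commute.2 (hw x), one_pow, mul_one]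
  have hck (x y z : G) : Commute (⁅x, y⁆ ^ k) z := (hc x y z).pow_left k
  have hone : e 1 = 1 := by
    have := hcentral (w := 1) (fun z => Commute.one_left z) 1
    simpa using this
  have hpow (x : G) (n : ℕ) : e x ^ n = e (x ^ n) := by
    induction n with
    | zero => simp [hone]
    | succ n ih =>
      rw [pow_succ, ih, he, commutatorElement_eq_one_iff_commute.2 ((Commute.refl x).pow_right n)]
      simp [pow_succ]
  obtain ⟨f, hf⟩ := exists_hom_zmod_ne_one (p := p) (A := A) (a := e a)
    (fun x => by obtain ⟨x, rfl⟩ := e.surjective x; rw [hpow, hG, hone])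
    (fun h => ha (e.injective (h.trans hone.symm)))
  refine ⟨fun x => (f (e x)).toAdd, fun x y => (f (e (⁅x, y⁆ ^ k))).toAdd, fun x y => ?_,
    fun x y z => ?_, fun h => hf ?_⟩
  · rw [← toAdd_mul, ← toAdd_mul, ← map_mul, ← map_mul, he,
      ← hcentral (hck x y), mul_assoc, ← commutatorElement_inv x y, inv_pow, inv_mul_cancel,
      mul_one]
  · beta_reduce
    rw [← toAdd_mul, ← map_mul, ← hcentral (hck y z), ← (hc x z _).mul_pow,
      commutatorElement_mul_left_of_central hc]
  · simpa [hone] using h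

end ClassTwo

/-! ### Elements central modulo F_4 -/

section CoprodCenter

open Monoid.Coprod

variable {G : Type u} {H : Type v} [Group G] [Group H] {p : ℕ}

theorem exists_translation_cocycle [NeZero p] {f : G → ZMod p}
    (hf : f ∈ augFiltration ((translation G (ZMod p)).comp (fst : Monoid.Coprod G H →* G)) 3)
    (β : H →* Multiplicative (ZMod p)) :
    ∃ w : Monoid.Coprod G H → G → ZMod p,
      (∀ x y, w (x * y) =
        w x + (translation G (ZMod p)).comp (fst : Monoid.Coprod G H →* G) x (w y)) ∧
      (∀ g, w (inl g) = 0) ∧ (∀ h y, w (inr h) y = (β h).toAdd * f y) ∧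
      ∀ x, w x ∈ augFiltration ((translation G (ZMod p)).comp
        (fst : Monoid.Coprod G H →* G)) 3 := by
  obtain ⟨w, hw, hl, hr⟩ := exists_coprod_cocycle (translation G (ZMod p)) (H := H)
    ((AddMonoidHom.toMultiplicative
      { toFun := fun c : ZMod p => fun y => c * f y
        map_zero' := by ext; simp
        map_add' := fun c d => by ext; simp [add_mul] }).comp β)
  have hr' (h : H) : w (inr h) = fun y => (β h).toAdd * f y := hr h
  refine ⟨w, hw, hl, fun h y => congrFun (hr' h) y, coprod_cocycle_mem hw
    (fun g => by rw [hl]; exact zero_mem _) fun h => ?_⟩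
  rw [hr']
  convert AddSubgroup.nsmul_mem _ hf (β h).toAdd.val using 1
  ext y
  simp

theorem fst_eq_one_of_commutator_mem (hp : p.Prime) (hodd : Odd p)
    (hG : ClassAtMost 2 G) (hGp : ∀ x : G, x ^ p = 1)
    [Group.IsSolvable H] [Nontrivial H] (hHp : ∀ x : H, x ^ p = 1) {x : Monoid.Coprod G H}
    (hx : ∀ y, ⁅x, y⁆ ∈ (⊤ : Subgroup (Monoid.Coprod G H)).lowerCentralSeries 3) :
    fst x = 1 := by
  have := Fact.mk hp
  by_contra hne
  obtain ⟨q, B, hq, hB, hqne⟩ :=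
    exists_quadratic_ne hG.commute_commutatorElement hp hodd hGp hne
  obtain ⟨β, h, hβ⟩ := exists_hom_zmod_ne_one_of_isSolvable H hHp
  obtain ⟨w, hw, hl, hr, hc⟩ := exists_translation_cocycle (G := G) (H := H) (f := q) (by
    refine mem_augFiltration_succ.2 fun a => mem_augFiltration_succ.2 fun b =>
      mem_augFiltration_succ.2 fun c => mem_augFiltration_zero.2 (funext fun y => ?_)
    simp [hq, hB]
    ring) β
  -- As `inr h` acts trivially, w x cancels.
  have h1 := congrFun (cocycle_comm hw hc (hx (inr h))) 1
  simp only [Pi.add_apply, MonoidHom.comp_apply, fst_apply_inr, translation_apply, hr, map_one,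
    one_mul, AddMonoid.End.coe_one, id_eq] at h1
  have h2 : (β h).toAdd * (q (fst x) - q 1) = 0 := by linear_combination h1
  rcases mul_eq_zero.1 h2 with h3 | h3
  · exact hβ h3
  · exact hqne (sub_eq_zero.1 h3)

theorem snd_eq_one_of_commutator_mem (hp : p.Prime) (hodd : Odd p)
    (hH : ClassAtMost 2 H) (hHp : ∀ x : H, x ^ p = 1)
    [Group.IsSolvable G] [Nontrivial G] (hGp : ∀ x : G, x ^ p = 1) {x : Monoid.Coprod G H}
    (hx : ∀ y, ⁅x, y⁆ ∈ (⊤ : Subgroup (Monoid.Coprod G H)).lowerCentralSeries 3) :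
    snd x = 1 := by
  rw [← fst_swap]
  refine fst_eq_one_of_commutator_mem hp hodd hH hHp hGp fun y => ?_
  have h := Subgroup.mem_map_of_mem (swap G H) (hx (swap H G y))
  rw [Subgroup.map_lowerCentralSeries, map_commutatorElement, swap_swap,
    Subgroup.map_top_of_surjective _ swap_surjective] at h
  exact h

variable (G H) in
/-- The set of commutators of elements of the first factor with elements of the second one. -/
def crossCommutators : Set (Monoid.Coprod G H) :=
  Set.range fun a : G × H => ⁅(inl a.1 : Monoid.Coprod G H), inr a.2⁆

/-- Modulo `C` the two factors commute, so the quotient map factors through G × H, where x is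
trivial. -/
theorem exists_closure_crossCommutators_mul {x : Monoid.Coprod G H} (h1 : fst x = 1)
    (h2 : snd x = 1) : ∃ d ∈ Subgroup.closure (crossCommutators G H),
      ∃ z ∈ (⊤ : Subgroup (Monoid.Coprod G H)).lowerCentralSeries 2, d * z = x := by
  set L := (⊤ : Subgroup (Monoid.Coprod G H)).lowerCentralSeries 2
  set C := Subgroup.closure (crossCommutators G H) ⊔ L
  have hC1 : C ≤ (⊤ : Subgroup (Monoid.Coprod G H)).lowerCentralSeries 1 := by
    refine sup_le ((Subgroup.closure_le _).2 ?_) (Subgroup.lowerCentralSeries_antitone _ one_le_two)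
    rintro _ ⟨a, rfl⟩
    exact Subgroup.commutator_mem_commutator trivial trivial
  have : C.Normal := ⟨fun c hc g => by
    rw [show g * c * g⁻¹ = ⁅c, g⁆⁻¹ * c by simp [commutatorElement_def, mul_assoc]]
    exact mul_mem (inv_mem (le_sup_right (a := Subgroup.closure (crossCommutators G H))
      (Subgroup.commutator_mem_commutator (hC1 hc) trivial))) hc⟩
  have hcomm (g : G) (h : H) : Commute ((QuotientGroup.mk' C).comp inl g)
      ((QuotientGroup.mk' C).comp inr h) := by
    rw [← commutatorElement_eq_one_iff_commute, MonoidHom.comp_apply, MonoidHom.comp_apply,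
      ← map_commutatorElement, ← MonoidHom.mem_ker, QuotientGroup.ker_mk']
    exact le_sup_left (b := L) (Subgroup.subset_closure ⟨(g, h), rfl⟩)
  have hfac : QuotientGroup.mk' C = (MonoidHom.noncommCoprod _ _ hcomm).comp toProd := by
    ext <;> simp
  have hxC : x ∈ C := by
    rw [← QuotientGroup.ker_mk' C, MonoidHom.mem_ker, hfac, MonoidHom.comp_apply,
      ← prod_mk_fst_snd, h1, h2]
    exact map_one _
  exact Subgroup.mem_sup_of_normal_right.1 hxC

/-- The central elements of order dividing `p` form a commutative group. -/
theorem exists_central_torsion (P : Type u) [Group P] (p : ℕ) :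
    ∃ (T : Type u) (_ : CommGroup T) (ι : T →* P), Function.Injective ι ∧
      (∀ t : T, t ^ p = 1) ∧ ∀ x : P, (∀ z, Commute x z) → x ^ p = 1 → ∃ t, ι t = x := by
  let S : Subgroup P :=
    { carrier := {x | (∀ z, Commute x z) ∧ x ^ p = 1}
      one_mem' := ⟨Commute.one_left, one_pow p⟩
      mul_mem' := fun {x y} hx hy => ⟨fun z => (hx.1 z).mul_left (hy.1 z), by
        rw [(hx.1 y).mul_pow, hx.2, hy.2, one_mul]⟩
      inv_mem' := fun {x} hx => ⟨fun z => (hx.1 z).inv_left, by rw [inv_pow, hx.2, inv_one]⟩ }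
  exact ⟨S, { S.toGroup with mul_comm := fun a b => Subtype.ext (a.2.1 b) }, S.subtype,
    Subtype.val_injective, fun t => Subtype.ext t.2.2, fun x h1 h2 => ⟨⟨x, h1, h2⟩, rfl⟩⟩

theorem mem_lowerCentralSeries_two_of_mem_closure [Finite G] (hp : p.Prime) (hodd : Odd p)
    (hGp : ∀ x : G, x ^ p = 1) {d : Monoid.Coprod G H}
    (hd : d ∈ Subgroup.closure (crossCommutators G H))
    (hx : ∀ y, ⁅d, y⁆ ∈ (⊤ : Subgroup (Monoid.Coprod G H)).lowerCentralSeries 3) :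
    d ∈ (⊤ : Subgroup (Monoid.Coprod G H)).lowerCentralSeries 2 := by
  have := Fact.mk hp
  set L := (⊤ : Subgroup (Monoid.Coprod G H)).lowerCentralSeries 2
  let π := QuotientGroup.mk' L
  have hc (x y z : Monoid.Coprod G H ⧸ L) : Commute ⁅x, y⁆ z := by
    obtain ⟨x, rfl⟩ := QuotientGroup.mk'_surjective L x
    obtain ⟨y, rfl⟩ := QuotientGroup.mk'_surjective L y
    obtain ⟨z, rfl⟩ := QuotientGroup.mk'_surjective L z
    rw [← commutatorElement_eq_one_iff_commute, ← map_commutatorElement, ← map_commutatorElement,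
      ← MonoidHom.mem_ker, QuotientGroup.ker_mk']
    exact Subgroup.commutator_mem_commutator
      (Subgroup.commutator_mem_commutator trivial trivial) trivial
  obtain ⟨T, _, ι, hι, hT, hιr⟩ := exists_central_torsion (Monoid.Coprod G H ⧸ L) p
  have hκ (g : G) (h : H) : ∃ t : T, ι t = ⁅π (inl g), π (inr h)⁆ :=
    hιr _ (hc _ _) (by
      rw [← commutatorElement_pow_left_of_central hc, ← map_pow, ← map_pow, hGp]
      simp)
  choose κ hκ using hκ
  have hκl (g g' : G) (h : H) : κ (g * g') h = κ g h * κ g' h := hι (by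
    simp only [hκ, map_mul, commutatorElement_mul_left_of_central hc])
  have hκr (g : G) (h h' : H) : κ g (h * h') = κ g h * κ g h' := hι (by
    simp only [hκ, map_mul, commutatorElement_mul_right_of_central hc])
  obtain ⟨t, ht⟩ : ∃ t : T, ι t = π d := by
    have : Subgroup.closure (crossCommutators G H) ≤ ι.range.comap π := by
      rw [Subgroup.closure_le]
      rintro _ ⟨a, rfl⟩
      exact ⟨κ a.1 a.2, by rw [hκ, map_commutatorElement]⟩
    exact this hd
  by_contra hdL
  obtain ⟨f, hf⟩ := exists_hom_zmod_ne_one (p := p) (A := T) (a := t)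
    hT (fun h => hdL (by
      rw [h, map_one] at ht
      rw [← QuotientGroup.ker_mk' L]
      exact ht.symm))
  obtain ⟨n, γ, α, hα, hb⟩ := exists_dual_family (p := p) G hGp
  -- Coefficients of the form f(κ(g, h)) in the dual family αᵢ.
  let β (i : Fin n) : H →* Multiplicative (ZMod p) :=
    f.comp (MonoidHom.mk' (κ (γ i)) (hκr (γ i)))
  have hw (i : Fin n) := exists_translation_cocycle (G := G) (H := H)
    (f := fun y => (α i y).toAdd ^ 2) (by
      refine mem_augFiltration_succ.2 fun a => mem_augFiltration_succ.2 fun b =>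
        mem_augFiltration_succ.2 fun c => mem_augFiltration_zero.2 (funext fun y => ?_)
      simp
      ring) (β i)
  choose w hw hl hr hwc using hw
  have hfst {e : Monoid.Coprod G H} (he : e ∈ Subgroup.closure (crossCommutators G H)) :
      fst e = 1 := by
    have : Subgroup.closure (crossCommutators G H) ≤ (fst : Monoid.Coprod G H →* G).ker := by
      rw [Subgroup.closure_le]
      rintro _ ⟨a, rfl⟩
      simp [MonoidHom.mem_ker, map_commutatorElement]
    exact this he
  have hadd {e e' : Monoid.Coprod G H} (he : e ∈ Subgroup.closure (crossCommutators G H)) (i) :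
      w i (e * e') = w i e + w i e' := by
    rw [hw, MonoidHom.comp_apply, hfst he, map_one_apply]
  -- On [g, h], wᵢ is y ↦ βᵢ(h)(αᵢ(yg)² - αᵢ(y)²); its values at γᵢ and 1 differ by 2αᵢ(g)βᵢ(h).
  have key {e : Monoid.Coprod G H} (he : e ∈ Subgroup.closure (crossCommutators G H)) :
      ∃ s : T, ι s = π e ∧ 2 * (f s).toAdd = ∑ i, (w i e (γ i) - w i e 1) := by
    induction he using Subgroup.closure_induction with
    | mem e he =>
      obtain ⟨⟨g, h⟩, rfl⟩ := he
      refine ⟨κ g h, by rw [hκ, map_commutatorElement], ?_⟩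
      rw [show (f (κ g h)).toAdd = _ from
        hb (f.comp (MonoidHom.mk' (fun g => κ g h) fun g g' => hκl g g' h)) g, Finset.mul_sum]
      refine Finset.sum_congr rfl fun i _ => ?_
      have hβ : (f (κ (γ i) h)).toAdd = (β i h).toAdd := rfl
      simp only [cocycle_commutator (hw i), hl, map_zero, add_zero, zero_add, Pi.sub_apply,
        MonoidHom.comp_apply, map_commutatorElement, fst_apply_inl, fst_apply_inr,
        commutatorElement_one_right, AddMonoid.End.coe_one, id_eq, translation_apply, hr, map_mul,
        toAdd_mul, hα, map_one, toAdd_one, MonoidHom.mk'_apply, hβ, one_mul]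
      ring
    | one => exact ⟨1, by simp, by simp [cocycle_one (hw _)]⟩
    | mul x y hx hy ihx ihy =>
      obtain ⟨s, hs, hs'⟩ := ihx
      obtain ⟨s', hss, hss'⟩ := ihy
      refine ⟨s * s', by rw [map_mul, map_mul, hs, hss], ?_⟩
      rw [map_mul, toAdd_mul, mul_add, hs', hss', ← Finset.sum_add_distrib]
      refine Finset.sum_congr rfl fun i _ => ?_
      simp only [hadd hx, Pi.add_apply]
      ring
    | inv x hx ihx =>
      obtain ⟨s, hs, hs'⟩ := ihx
      refine ⟨s⁻¹, by rw [map_inv, map_inv, hs], ?_⟩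
      rw [map_inv, toAdd_inv, mul_neg, hs', ← Finset.sum_neg_distrib]
      refine Finset.sum_congr rfl fun i _ => ?_
      have h0 : w i x⁻¹ = -w i x := by
        have := hadd (e' := x⁻¹) hx i
        rw [mul_inv_cancel, cocycle_one (hw i)] at this
        exact (neg_eq_of_add_eq_zero_right this.symm).symm
      simp only [h0, Pi.neg_apply]
      ring
  obtain ⟨s, hs, hs'⟩ := key hd
  obtain rfl : s = t := hι (hs.trans ht.symm)
  refine hf (Multiplicative.toAdd.injective ?_)
  rw [Finset.sum_eq_zero fun i _ => ?_] at hs'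
  · refine (mul_eq_zero.1 hs').resolve_left fun h2 => ?_
    have : p ∣ 2 := (ZMod.natCast_eq_zero_iff 2 p).1 (by exact_mod_cast h2)
    rcases (Nat.dvd_prime Nat.prime_two).1 this with h | h
    · exact hp.one_lt.ne' h
    · exact absurd hodd (by rw [h]; decide)
  -- As wᵢ vanishes on G, the relation says that γᵢ fixes wᵢ(d).
  · have h1 := congrFun (cocycle_comm (hw i) (hwc i) (hx (inl (γ i)))) 1
    simp only [hl, map_zero, add_zero, zero_add, MonoidHom.comp_apply, fst_apply_inl,
      translation_apply, one_mul] at h1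
    rw [h1, sub_self]

theorem mem_lowerCentralSeries_two_of_commutator_mem [Finite G] [Nontrivial G] [Nontrivial H]
    (hp : p.Prime) (hodd : Odd p) (hG : ClassAtMost 2 G) (hGp : ∀ x : G, x ^ p = 1)
    (hH : ClassAtMost 2 H) (hHp : ∀ x : H, x ^ p = 1) {x : Monoid.Coprod G H}
    (hx : ∀ y, ⁅x, y⁆ ∈ (⊤ : Subgroup (Monoid.Coprod G H)).lowerCentralSeries 3) :
    x ∈ (⊤ : Subgroup (Monoid.Coprod G H)).lowerCentralSeries 2 := by
  have : Group.IsNilpotent G := Subgroup.nilpotent_iff_lowerCentralSeries.2 ⟨2, hG⟩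
  have : Group.IsNilpotent H := Subgroup.nilpotent_iff_lowerCentralSeries.2 ⟨2, hH⟩
  obtain ⟨d, hd, z, hz, rfl⟩ := exists_closure_crossCommutators_mul
    (fst_eq_one_of_commutator_mem hp hodd hG hGp hHp hx)
    (snd_eq_one_of_commutator_mem hp hodd hH hHp hGp hx)
  refine mul_mem (mem_lowerCentralSeries_two_of_mem_closure hp hodd hGp hd fun y => ?_) hz
  have h := hx y
  rw [commutatorElement_mul_left_eq_conj_mul] at h
  exact (Subgroup.mul_mem_cancel_left _ (Subgroup.Normal.conj_mem inferInstance _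
    (Subgroup.commutator_mem_commutator hz (Subgroup.mem_top y)) d)).1 h

end CoprodCenter

/-- The hypothesis bounds the center of `F ⧸ L` from above; the reverse inclusion is automatic. -/
theorem isCapable_quotient_lowerCentralSeries {F : Type u} [Group F] {k : ℕ}
    (h : ∀ x : F, (∀ y, ⁅x, y⁆ ∈ (⊤ : Subgroup F).lowerCentralSeries (k + 1)) →
      x ∈ (⊤ : Subgroup F).lowerCentralSeries k) :
    IsCapable (F ⧸ (⊤ : Subgroup F).lowerCentralSeries k) := by
  let L := (⊤ : Subgroup F).lowerCentralSeries (k + 1)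
  let f : F →* (F ⧸ L) ⧸ Subgroup.center (F ⧸ L) :=
    (QuotientGroup.mk' _).comp (QuotientGroup.mk' L)
  have hf : Function.Surjective f :=
    (QuotientGroup.mk'_surjective _).comp (QuotientGroup.mk'_surjective _)
  have hker : (⊤ : Subgroup F).lowerCentralSeries k = f.ker := by
    ext x
    have : x ∈ f.ker ↔ ∀ y, ⁅x, y⁆ ∈ L := by
      rw [← MonoidHom.comap_ker, QuotientGroup.ker_mk', Subgroup.mem_comap,
        Subgroup.mem_center_iff, (QuotientGroup.mk'_surjective L).forall]
      refine forall_congr' fun y => ?_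
      rw [eq_comm, ← commutatorElement_eq_one_iff_mul_comm, ← map_commutatorElement,
        ← MonoidHom.mem_ker, QuotientGroup.ker_mk']
    rw [this]
    exact ⟨fun hx y => Subgroup.commutator_mem_commutator hx trivial, h x⟩
  exact ⟨F ⧸ L, inferInstance, ⟨(QuotientGroup.quotientMulEquivOfEq hker).trans
    (QuotientGroup.quotientKerEquivOfSurjective f hf)⟩⟩

theorem mainTheorem5 {p : ℕ} (hp : p.Prime) (hodd : Odd p)
    (G : Type u) [Group G] [Finite G] [Nontrivial G]
    (H : Type v) [Group H] [Finite H] [Nontrivial H]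
    (hG : ClassAtMost 2 G) (hGp : Monoid.exponent G = p)
    (hH : ClassAtMost 2 H) (hHp : Monoid.exponent H = p) :
    IsCapable (NilpotentProduct 2 G H) :=
  isCapable_quotient_lowerCentralSeries fun _ =>
    mem_lowerCentralSeries_two_of_commutator_mem hp hodd
      hG (fun x => hGp ▸ Monoid.pow_exponent_eq_one x)
      hH (fun x => hHp ▸ Monoid.pow_exponent_eq_one x)
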